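/- Let $n, d \ge 2$ be coprime integers. Let $\mathcal{C}$ be the smooth projective model over $\mathbf{C}$ of the affine plane curve $y^n = x^d + x$, let $\infty$ be its unique point at infinity (the unique pole of $x$), and let $J$ be the Jacobian of $\mathcal{C}$. Suppose that $P \in \mathcal{C}(\mathbf{C})$ satisfies $P \neq \infty$ and $d[P - \infty] = 0$ in $J$. Then $d = 2$ or $(n, d) = (2, 3)$. -/

import Mathlib

open scoped WithZero

noncomputable section

/-! ### Curves as function fields over `ℂ`

The smooth projective curve over `ℂ` with function field `F` is described by `F` itself:
its points are the discrete valuations of `F` that are trivial on `ℂ`, and a divisor is a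
finitely supported integer-valued function on these points. -/

/-- A (closed) point of the smooth projective curve with function field `F`: a normalized
(i.e. surjective onto `ℤ ∪ {∞}`, written multiplicatively) discrete valuation of `F` that is
trivial on `ℂ`. -/
@[ext]
structure CurvePoint (F : Type*) [Field F] [Algebra ℂ F] where
  /-- the valuation, in multiplicative notation: `val f < 1` iff `f` vanishes at the point -/
  val : Valuation F ℤᵐ⁰
  surjective : Function.Surjective val
  trivialOn : val.IsTrivialOn ℂ

namespace CurvePoint

variable {F : Type*} [Field F] [Algebra ℂ F]

/-- The order of vanishing of `f` at `P` (positive at zeros, negative at poles); it is only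
meaningful for `f ≠ 0`. -/
def ord (P : CurvePoint F) (f : F) : ℤ := - WithZero.log (P.val f)

end CurvePoint

/-- Divisors on the smooth projective curve with function field `F`. -/
abbrev CurveDivisor (F : Type*) [Field F] [Algebra ℂ F] : Type _ := CurvePoint F →₀ ℤ

namespace CurveDivisor

variable (F : Type*) [Field F] [Algebra ℂ F]

/-- The degree of a divisor; every point has residue field `ℂ`, hence degree one. -/
def degree : CurveDivisor F →+ ℤ := Finsupp.liftAddHom fun _ => AddMonoidHom.id ℤ

/-- The principal divisors: `D` such that `D = div f` for some nonzero rational function `f`. -/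
def principal : AddSubgroup (CurveDivisor F) where
  carrier := {D | ∃ f : F, f ≠ 0 ∧ ∀ P : CurvePoint F, D P = P.ord f}
  zero_mem' := ⟨1, one_ne_zero, fun P => by simp [CurvePoint.ord]⟩
  add_mem' := by
    rintro D E ⟨f, hf, hD⟩ ⟨g, hg, hE⟩
    refine ⟨f * g, mul_ne_zero hf hg, fun P => ?_⟩
    have h1 : P.val f ≠ 0 := (Valuation.ne_zero_iff _).2 hf
    have h2 : P.val g ≠ 0 := (Valuation.ne_zero_iff _).2 hg
    rw [Finsupp.add_apply, hD, hE]
    simp only [CurvePoint.ord, map_mul, WithZero.log_mul h1 h2]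
    ring
  neg_mem' := by
    rintro D ⟨f, hf, hD⟩
    refine ⟨f⁻¹, inv_ne_zero hf, fun P => ?_⟩
    rw [Finsupp.neg_apply, hD]
    simp [CurvePoint.ord, WithZero.log_inv]

end CurveDivisor

/-- The group of points of the Jacobian: divisors of degree zero modulo the principal divisors
of degree zero. -/
abbrev Jacobian (F : Type*) [Field F] [Algebra ℂ F] : Type _ :=
  (CurveDivisor.degree F).ker ⧸
    (CurveDivisor.principal F).addSubgroupOf (CurveDivisor.degree F).ker

/-- The Abel–Jacobi map with base point `B`: the class `[P - B]` in the Jacobian. -/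
def abelJacobi {F : Type*} [Field F] [Algebra ℂ F] (B P : CurvePoint F) : Jacobian F :=
  QuotientAddGroup.mk
    ⟨Finsupp.single P 1 - Finsupp.single B 1, by
      rw [AddMonoidHom.mem_ker, map_sub, CurveDivisor.degree, Finsupp.liftAddHom_apply_single,
        Finsupp.liftAddHom_apply_single, sub_self]⟩

/-! ### The curve `y ^ n = x ^ d + x` -/

namespace CurveXdX

open Polynomial

/-- The polynomial `Y ^ n - (X ^ d + X)` in `ℂ[X][Y]`. -/
def equation (n d : ℕ) : ℂ[X][X] := X ^ n - C (X ^ d + X)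

variable (n d : ℕ)

/-- The affine coordinate ring `ℂ[X, Y] / (Y ^ n - X ^ d - X)`. -/
abbrev CoordinateRing : Type := AdjoinRoot (equation n d)

lemma equation_monic [n.AtLeastTwo] : (equation n d).Monic :=
  monic_X_pow_sub_C _ (by have := Nat.AtLeastTwo.prop (n := n); omega)

lemma equation_natDegree : (equation n d).natDegree = n := natDegree_X_pow_sub_C

lemma equation_irreducible [n.AtLeastTwo] [d.AtLeastTwo] : Irreducible (equation n d) := by
  have hn := Nat.AtLeastTwo.prop (n := n)
  have hd := Nat.AtLeastTwo.prop (n := d)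
  have hX : Prime (X : ℂ[X]) := prime_X
  refine irreducible_of_eisenstein_criterion (P := Ideal.span {X})
    ((Ideal.span_singleton_prime X_ne_zero).2 hX) ?_ ?_ ?_ ?_ (equation_monic n d).isPrimitive
  · rw [(equation_monic n d).leadingCoeff, Ideal.mem_span_singleton]
    exact hX.not_dvd_one
  · intro k hk
    rw [degree_eq_natDegree (equation_monic n d).ne_zero, equation_natDegree] at hk
    have hk' : k < n := by exact_mod_cast hk
    rw [Ideal.mem_span_singleton, equation, coeff_sub, coeff_X_pow, if_neg (by omega), coeff_C]
    split_ifs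
    · rw [zero_sub, dvd_neg]
      exact dvd_add (dvd_pow_self _ (by omega)) dvd_rfl
    · simp
  · rw [← natDegree_pos_iff_degree_pos, equation_natDegree]; omega
  · rw [Ideal.span_singleton_pow, Ideal.mem_span_singleton, equation, coeff_sub, coeff_X_pow,
      if_neg (by omega), coeff_C_zero, zero_sub, dvd_neg, X_pow_dvd_iff]
    intro h
    have := h 1 (by norm_num)
    rw [coeff_add, coeff_X_pow, if_neg (by omega)] at this
    simp at this

instance [n.AtLeastTwo] [d.AtLeastTwo] : IsDomain (CoordinateRing n d) :=
  AdjoinRoot.isDomain_of_prime (equation_irreducible n d).prime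

/-- The function field of the curve. -/
abbrev FunctionField : Type := FractionRing (CoordinateRing n d)

/-- The rational function `x`. -/
def x : FunctionField n d :=
  algebraMap (CoordinateRing n d) _ (AdjoinRoot.of (equation n d) X)

/-- The rational function `y`. -/
def y : FunctionField n d :=
  algebraMap (CoordinateRing n d) _ (AdjoinRoot.root (equation n d))

lemma y_pow : y n d ^ n = x n d ^ d + x n d := by
  have h : (AdjoinRoot.root (equation n d)) ^ n =
      AdjoinRoot.of (equation n d) (X ^ d + X) := by
    have := AdjoinRoot.eval₂_root (equation n d)
    rw [equation, eval₂_sub, eval₂_X_pow, eval₂_C, sub_eq_zero] at this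
    exact this
  rw [y, x, ← map_pow, h, map_add, map_pow, map_add, map_pow]

lemma algebraMap_mk (q : ℂ[X][X]) :
    algebraMap (CoordinateRing n d) (FunctionField n d) (AdjoinRoot.mk (equation n d) q) =
      q.sum fun j c => aeval (x n d) c * y n d ^ j := by
  have hc : ∀ c : ℂ[X], algebraMap (CoordinateRing n d) (FunctionField n d)
      (AdjoinRoot.of (equation n d) c) = aeval (x n d) c := by
    intro c
    induction c using Polynomial.induction_on' with
    | add p q hp hq => simp only [map_add, hp, hq]
    | monomial k a =>
      rw [← C_mul_X_pow_eq_monomial, map_mul, map_mul, map_pow, map_pow, aeval_mul, aeval_C,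
        map_pow, aeval_X, x]
      rfl
  conv_lhs => rw [q.as_sum_support_C_mul_X_pow]
  rw [map_sum, map_sum, Polynomial.sum]
  refine Finset.sum_congr rfl fun j _ => ?_
  rw [map_mul, map_pow, AdjoinRoot.mk_X, AdjoinRoot.mk_C, map_mul, map_pow, hc, y]

lemma x_transcendental [n.AtLeastTwo] : Transcendental ℂ (x n d) := by
  rw [transcendental_iff]
  intro p hp
  have h := algebraMap_mk n d (C p)
  rw [Polynomial.sum_C_index (by simp), pow_zero, mul_one, hp] at h
  have h0 := (IsFractionRing.to_map_eq_zero_iff).1 h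
  rw [AdjoinRoot.mk_eq_zero] at h0
  by_contra hne
  have := Polynomial.natDegree_le_of_dvd h0 (C_ne_zero.2 hne)
  rw [equation_natDegree, natDegree_C] at this
  have hn := Nat.AtLeastTwo.prop (n := n)
  omega

section Infinity

variable [n.AtLeastTwo] [d.AtLeastTwo]

lemma adjoin_x_y : IntermediateField.adjoin ℂ {x n d, y n d} = ⊤ := by
  rw [eq_top_iff]
  intro f _
  set E := IntermediateField.adjoin ℂ {x n d, y n d}
  have hx : x n d ∈ E := IntermediateField.subset_adjoin _ _ (by simp)
  have hy : y n d ∈ E := IntermediateField.subset_adjoin _ _ (by simp)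
  have hR : ∀ a : CoordinateRing n d, algebraMap _ (FunctionField n d) a ∈ E := by
    intro a
    obtain ⟨q, rfl⟩ := AdjoinRoot.mk_surjective a
    rw [algebraMap_mk, Polynomial.sum]
    refine sum_mem fun j _ => mul_mem ?_ (pow_mem hy j)
    rw [aeval_eq_sum_range]
    exact sum_mem fun i _ => E.smul_mem (pow_mem hx i)
  obtain ⟨a, b, hb, rfl⟩ := IsFractionRing.div_surjective (A := CoordinateRing n d) f
  exact div_mem (hR a) (hR b)

lemma finiteDimensional_of_adjoin {K F : Type} [Field K] [Field F] [Algebra ℂ K] [Algebra ℂ F] [Algebra K F]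
    [IsScalarTower ℂ K F] (u w : F) (a : K) (hu : u = algebraMap K F a)
    (hgen : IntermediateField.adjoin ℂ {u, w} = ⊤) {n : ℕ} (hn : 0 < n) {f : ℂ[X]}
    (hw : w ^ n = aeval u f) : FiniteDimensional K F := by
  have hint : IsIntegral K w := by
    refine IsIntegral.of_pow hn ?_
    rw [hw, hu, aeval_algebraMap_apply]
    exact isIntegral_algebraMap
  have htop : IntermediateField.adjoin K {w} = ⊤ := by
    have h : IntermediateField.adjoin ℂ {u, w} ≤
        (IntermediateField.adjoin K {w}).restrictScalars ℂ := by
      rw [IntermediateField.adjoin_le_iff, Set.insert_subset_iff, Set.singleton_subset_iff]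
      refine ⟨?_, IntermediateField.mem_adjoin_simple_self K w⟩
      rw [hu]
      exact (IntermediateField.adjoin K {w}).algebraMap_mem a
    rw [hgen] at h
    exact eq_top_iff.2 fun z _ => h (IntermediateField.mem_top)
  have := IntermediateField.adjoin.finiteDimensional hint
  rw [htop] at this
  exact IntermediateField.topEquiv.toLinearEquiv.finiteDimensional

lemma exists_val {F : Type} [Field F] [Algebra ℂ F] (u w : F) (hu : Transcendental ℂ u)
    (hgen : IntermediateField.adjoin ℂ {u, w} = ⊤) {n : ℕ} (hn : 0 < n) {f : ℂ[X]}
    (hw : w ^ n = aeval u f) :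
    ∃ v : Valuation F ℤᵐ⁰, Function.Surjective v ∧ v.IsTrivialOn ℂ ∧ 1 < v u := by
  have hu0 : u ≠ 0 := fun h => hu (h ▸ isAlgebraic_zero)
  let : Algebra ℂ[X] F := (aeval (R := ℂ) u⁻¹).toRingHom.toAlgebra
  have hmap : ∀ p : ℂ[X], algebraMap ℂ[X] F p = aeval u⁻¹ p := fun _ => rfl
  have hinj : Function.Injective (algebraMap ℂ[X] F) := by
    have : Transcendental ℂ u⁻¹ := fun h => hu (IsAlgebraic.inv_iff.1 h)
    exact transcendental_iff_injective.1 this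
  have : FaithfulSMul ℂ[X] F := (faithfulSMul_iff_algebraMap_injective _ _).2 hinj
  have : IsScalarTower ℂ ℂ[X] F := IsScalarTower.of_algebraMap_eq fun c => by simp [hmap]
  let := FractionRing.liftAlgebra ℂ[X] F
  have : IsScalarTower ℂ (FractionRing ℂ[X]) F := IsScalarTower.of_algebraMap_eq fun c => by
    rw [IsScalarTower.algebraMap_apply ℂ ℂ[X] F,
      IsScalarTower.algebraMap_apply ℂ[X] (FractionRing ℂ[X]) F,
      IsScalarTower.algebraMap_apply ℂ ℂ[X] (FractionRing ℂ[X])]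
  have : FiniteDimensional (FractionRing ℂ[X]) F := by
    refine finiteDimensional_of_adjoin u w (algebraMap ℂ[X] _ X)⁻¹ ?_ hgen hn hw
    rw [map_inv₀, ← IsScalarTower.algebraMap_apply, hmap, aeval_X, inv_inv]
  have : IsFractionRing (integralClosure ℂ[X] F) F :=
    integralClosure.isFractionRing_of_finite_extension (FractionRing ℂ[X]) F
  have : CharZero (FractionRing ℂ[X]) := inferInstance
  have hD : IsDedekindDomain (integralClosure ℂ[X] F) := 
    integralClosure.isDedekindDomain ℂ[X] (FractionRing ℂ[X]) F
  let t : integralClosure ℂ[X] F := algebraMap ℂ[X] _ X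
  have ht : algebraMap (integralClosure ℂ[X] F) F t = u⁻¹ := by
    change algebraMap ℂ[X] F X = _
    rw [hmap, aeval_X]
  have ht0 : t ≠ 0 := fun h => inv_ne_zero hu0 (by rw [← ht, h, map_zero])
  have htu : ¬ IsUnit t := by
    intro h
    have : FaithfulSMul ℂ[X] (integralClosure ℂ[X] F) := inferInstance
    exact not_isUnit_X (IsUnit.of_map (algebraMap ℂ[X] (integralClosure ℂ[X] F)) X h)
  obtain ⟨M, hM, htM⟩ := exists_max_ideal_of_mem_nonunits htu
  let P : IsDedekindDomain.HeightOneSpectrum (integralClosure ℂ[X] F) :=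
    ⟨M, hM.isPrime, fun h => ht0 (by simpa [h] using htM)⟩
  refine ⟨P.valuation F, P.valuation_surjective F, ⟨fun c hc => ?_⟩, ?_⟩
  · have h1 : ∀ c : ℂ, P.valuation F (algebraMap ℂ F c) ≤ 1 := fun c => by
      have := P.valuation_le_one (K := F) (algebraMap ℂ[X] _ (C c))
      change P.valuation F (algebraMap ℂ[X] F (C c)) ≤ 1 at this
      rwa [hmap, aeval_C] at this
    refine le_antisymm (h1 c) ?_
    have := h1 c⁻¹
    rw [map_inv₀, map_inv₀] at this
    exact (inv_le_one₀ (by simp [zero_lt_iff, hc])).1 this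
  · have := (P.valuation_lt_one_iff_mem (K := F) t).2 htM
    change P.valuation F (algebraMap (integralClosure ℂ[X] F) F t) < 1 at this
    rw [ht, map_inv₀] at this
    exact (inv_lt_one₀ (by simp [zero_lt_iff, hu0])).1 this

lemma exists_pole_x : ∃ P : CurvePoint (FunctionField n d), P.ord (x n d) < 0 := by
  obtain ⟨v, h1, h2, h3⟩ := exists_val (x n d) (y n d) (x_transcendental n d) (adjoin_x_y n d)
    (n := n) (f := X ^ d + X) (by have := Nat.AtLeastTwo.prop (n := n); omega)
    (by rw [y_pow]; simp)
  refine ⟨⟨v, h1, h2⟩, ?_⟩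
  rw [CurvePoint.ord, neg_lt_zero, WithZero.lt_log_iff_exp_lt (by intro h; simp [h] at h3)]
  simpa using h3

/-- At a pole of `x`, the pole orders of `x` and `y` are `n * m` and `d * m` for some `m > 0`. -/
lemma exists_val_eq (h : n.Coprime d) (P : CurvePoint (FunctionField n d))
    (hP : P.ord (x n d) < 0) : ∃ m : ℤ, 0 < m ∧
      P.val (x n d) = WithZero.exp (n * m) ∧ P.val (y n d) = WithZero.exp (d * m) := by
  have hn := Nat.AtLeastTwo.prop (n := n)
  have hd := Nat.AtLeastTwo.prop (n := d)
  have htriv := P.trivialOn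
  rw [CurvePoint.ord, neg_lt_zero] at hP
  have hx0 : P.val (x n d) ≠ 0 := by intro h0; simp [h0] at hP
  have hx1 : 1 < P.val (x n d) := by
    rw [WithZero.lt_log_iff_exp_lt hx0] at hP; simpa using hP
  have hdeg : ((X ^ d + X : ℂ[X])).natDegree = d := by
    have : (X : ℂ[X]).natDegree < (X ^ d : ℂ[X]).natDegree := by
      rw [natDegree_X, natDegree_X_pow]; omega
    rw [natDegree_add_eq_left_of_natDegree_lt this, natDegree_X_pow]
  have hne : (X ^ d + X : ℂ[X]) ≠ 0 := by
    intro h0; rw [h0, natDegree_zero] at hdeg; omega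
  have key : P.val (y n d) ^ n = P.val (x n d) ^ d := by
    have := valuation_aeval_eq_valuation_X_pow_natDegree_of_one_lt_valuation_X
      (v := P.val) (x n d) hx1 hne
    rw [hdeg] at this
    rw [← map_pow, y_pow, ← this]
    simp
  have hy0 : P.val (y n d) ≠ 0 := by
    intro h0
    rw [h0, zero_pow (by omega)] at key
    exact pow_ne_zero _ hx0 key.symm
  have hlog := congrArg WithZero.log key
  rw [WithZero.log_pow, WithZero.log_pow, nsmul_eq_mul, nsmul_eq_mul] at hlog
  have hdvd : (n : ℤ) ∣ WithZero.log (P.val (x n d)) := by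
    refine IsCoprime.dvd_of_dvd_mul_left (Nat.isCoprime_iff_coprime.2 h) ⟨_, hlog.symm⟩
  obtain ⟨m, hm⟩ := hdvd
  have hn0 : (n : ℤ) ≠ 0 := by omega
  refine ⟨m, ?_, ?_, ?_⟩
  · rw [hm] at hP
    exact pos_of_mul_pos_right hP (by omega)
  · rw [← hm, WithZero.exp_log hx0]
  · have : WithZero.log (P.val (y n d)) = d * m := by
      rw [hm] at hlog
      apply mul_left_cancel₀ hn0
      rw [hlog]; ring
    rw [← this, WithZero.exp_log hy0]

lemma exists_weight (h : n.Coprime d) (q : ℂ[X][X]) (hq : q ≠ 0) (hqn : q.natDegree < n) :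
    ∃ e : ℤ, ∀ (P : CurvePoint (FunctionField n d)) (m : ℤ), 0 < m →
      P.val (x n d) = WithZero.exp (n * m) → P.val (y n d) = WithZero.exp (d * m) →
      P.val (q.sum fun j c => aeval (x n d) c * y n d ^ j) = WithZero.exp (e * m) := by
  classical
  have hn := Nat.AtLeastTwo.prop (n := n)
  obtain ⟨j, hj, hmax⟩ := Finset.exists_max_image q.support
    (fun i => n * (q.coeff i).natDegree + d * i) (nonempty_support_iff.2 hq)
  refine ⟨(n * (q.coeff j).natDegree + d * j : ℕ), fun P m hm hx hy => ?_⟩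
  have htriv := P.trivialOn
  have hx1 : 1 < P.val (x n d) := by
    rw [hx, ← WithZero.exp_zero, WithZero.exp_lt_exp]
    have : (0 : ℤ) < n := by omega
    positivity
  have hterm : ∀ i ∈ q.support, P.val (aeval (x n d) (q.coeff i) * y n d ^ i) =
      WithZero.exp ((n * (q.coeff i).natDegree + d * i : ℕ) * m) := by
    intro i hi
    rw [map_mul, map_pow, valuation_aeval_eq_valuation_X_pow_natDegree_of_one_lt_valuation_X
      (x n d) hx1 (mem_support_iff.1 hi), hx, hy, ← WithZero.exp_nsmul, ← WithZero.exp_nsmul,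
      ← WithZero.exp_add]
    congr 1
    simp only [nsmul_eq_mul]
    push_cast
    ring
  rw [Polynomial.sum, Valuation.map_sum_eq_of_lt _ hj, hterm j hj]
  intro i hi
  rw [Finset.mem_sdiff, Finset.mem_singleton] at hi
  rw [hterm i hi.1, hterm j hj, WithZero.exp_lt_exp]
  refine mul_lt_mul_of_pos_right ?_ hm
  refine Int.ofNat_lt.2 (lt_of_le_of_ne (hmax i hi.1) fun heq => hi.2 ?_)
  have hi' : i < n := lt_of_le_of_lt (le_natDegree_of_mem_supp _ hi.1) hqn
  have hj' : j < n := lt_of_le_of_lt (le_natDegree_of_mem_supp _ hj) hqn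
  have hmod : d * i ≡ d * j [MOD n] := by
    have : n * (q.coeff i).natDegree + d * i ≡ n * (q.coeff j).natDegree + d * j [MOD n] := by
      rw [heq]
    simpa [Nat.ModEq, Nat.mul_add_mod] using this
  exact (Nat.ModEq.cancel_left_of_coprime h hmod).eq_of_lt_of_lt hi' hj'

lemma exists_weight' (h : n.Coprime d) (f : FunctionField n d) (hf : f ≠ 0) :
    ∃ e : ℤ, ∀ (P : CurvePoint (FunctionField n d)) (m : ℤ), 0 < m →
      P.val (x n d) = WithZero.exp (n * m) → P.val (y n d) = WithZero.exp (d * m) →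
      P.val f = WithZero.exp (e * m) := by
  have hn := Nat.AtLeastTwo.prop (n := n)
  have hR : ∀ a : CoordinateRing n d, a ≠ 0 →
      ∃ e : ℤ, ∀ (P : CurvePoint (FunctionField n d)) (m : ℤ), 0 < m →
        P.val (x n d) = WithZero.exp (n * m) → P.val (y n d) = WithZero.exp (d * m) →
        P.val (algebraMap _ _ a) = WithZero.exp (e * m) := by
    intro a ha
    obtain ⟨q, rfl⟩ := AdjoinRoot.mk_surjective a
    have hm := equation_monic n d
    have hmk : AdjoinRoot.mk (equation n d) (q %ₘ equation n d) =
        AdjoinRoot.mk (equation n d) q := by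
      rw [AdjoinRoot.mk_eq_mk, modByMonic_eq_sub_mul_div]
      exact ⟨-(q /ₘ equation n d), by ring⟩
    rw [← hmk] at ha ⊢
    rw [algebraMap_mk]
    refine exists_weight n d h _ (fun h0 => ha (by rw [h0, map_zero])) ?_
    have := natDegree_modByMonic_lt q hm (fun h1 => by
      have := equation_natDegree n d
      rw [h1, natDegree_one] at this
      omega)
    rwa [equation_natDegree] at this
  obtain ⟨a, b, hb, rfl⟩ := IsFractionRing.div_surjective (A := CoordinateRing n d) f
  have ha : a ≠ 0 := fun h0 => hf (by rw [h0, map_zero, zero_div])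
  obtain ⟨e₁, h₁⟩ := hR a ha
  obtain ⟨e₂, h₂⟩ := hR b (nonZeroDivisors.ne_zero hb)
  refine ⟨e₁ - e₂, fun P m hm hx hy => ?_⟩
  rw [map_div₀, h₁ P m hm hx hy, h₂ P m hm hx hy, ← WithZero.exp_sub, sub_mul]

/-- If `n` and `d` are coprime, the curve has a unique point at infinity. -/
theorem existsUnique_pole_x (h : n.Coprime d) :
    ∃! P : CurvePoint (FunctionField n d), P.ord (x n d) < 0 := by
  have key : ∀ P : CurvePoint (FunctionField n d), P.ord (x n d) < 0 →
      P.val (x n d) = WithZero.exp ((n : ℤ) * 1) ∧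
        P.val (y n d) = WithZero.exp ((d : ℤ) * 1) := by
    intro P hP
    obtain ⟨m, hm, hx, hy⟩ := exists_val_eq n d h P hP
    obtain ⟨f, hf⟩ := P.surjective (WithZero.exp 1)
    have hf0 : f ≠ 0 := by
      rintro rfl
      rw [map_zero] at hf
      exact WithZero.exp_ne_zero hf.symm
    obtain ⟨e, he⟩ := exists_weight' n d h f hf0
    have h1 := he P m hm hx hy
    rw [hf, WithZero.exp_inj] at h1
    have : m = 1 := Int.eq_one_of_dvd_one hm.le ⟨e, by rw [h1]; ring⟩
    subst this
    exact ⟨hx, hy⟩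
  obtain ⟨P, hP⟩ := exists_pole_x n d
  refine ⟨P, hP, fun Q hQ => ?_⟩
  ext f : 2
  by_cases hf : f = 0
  · rw [hf, map_zero, map_zero]
  · obtain ⟨e, he⟩ := exists_weight' n d h f hf
    rw [he P 1 one_pos (key P hP).1 (key P hP).2, he Q 1 one_pos (key Q hQ).1 (key Q hQ).2]

/-- The point at infinity: the unique point of the curve at which `x` has a pole. -/
def infinity (h : n.Coprime d) : CurvePoint (FunctionField n d) :=
  (existsUnique_pole_x n d h).choose

end Infinity

end CurveXdX

end

/-!
If `d [P - ∞] = 0` with `P ≠ ∞`, there is a function `f` with divisor `d P - d ∞`. Since `f` has no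
pole on the affine curve, it lies in the coordinate ring `ℂ[x, y]`, provided that this ring is
integrally closed: the discriminant of `1, y, …, y ^ (n - 1)` is a constant times
`(x ^ d + x) ^ (n - 1)`, and `y ^ n - (x ^ d + x)` is Eisenstein at each prime factor of the
squarefree polynomial `x ^ d + x`.

At infinity `x` and `y` have poles of the coprime orders `n` and `d`, so a function
`∑ c_j(x) y ^ j` (`j < n`) with a pole of order exactly `d` there is `u y + c(x)` with `u ≠ 0` and
`n * deg c < d` (`exists_eq_add_of_ord_infinity`). Put `p = -c / u`. Each root `r` of the monic
polynomial `x ^ d + x - p ^ n` of degree `d` gives a zero `(r, p(r))` of `f`, hence equals the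
`x`-coordinate of `P`; therefore `p ^ n + (x - a) ^ d = x ^ d + x` for some `a`.

For `d ≥ 3` this identity leaves only `(n, d) = (2, 3)` (`eq_two_or_of_pow_add_eq`). If `n = 2`,
the reflection `x ↦ a - x` gives `p(x) ^ 2 - p(a - x) ^ 2 = 2 x - a`, which forces `p` to be
linear. If `n ≥ 3`, the multiplicity of the roots of `p ^ n` makes `p` divide `(d - 2) x + a`, and
comparison of the two leading coefficients of `p ^ n` leads to `d = 0`.
-/

noncomputable section

/-! ### The polynomial identity `p ^ n + (X - a) ^ d = X ^ d + X` -/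

namespace CurveXdX
open Polynomial

lemma coeff_X_sub_C_pow (a : ℂ) (d k : ℕ) :
    ((X - C a) ^ d).coeff k = (-a) ^ (d - k) * (d.choose k : ℂ) := by
  rw [sub_eq_add_neg, ← C_neg, coeff_X_add_C_pow]

lemma natDegree_of_pow_add_eq {n d : ℕ} (hn : 2 ≤ n) (hd : 3 ≤ d) {p : ℂ[X]} {a : ℂ}
    (h : p ^ n + (X - C a) ^ d = X ^ d + X) : a ≠ 0 ∧ n * p.natDegree = d - 1 := by
  have ha : a ≠ 0 := by
    rintro rfl
    have h1 : p ^ n = X := by simpa [add_comm] using h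
    have h2 := congrArg natDegree h1
    rw [natDegree_pow, natDegree_X] at h2
    have := Nat.eq_one_of_mul_eq_one_right h2
    omega
  refine ⟨ha, ?_⟩
  have hp : p ^ n = X ^ d + X - (X - C a) ^ d := eq_sub_of_add_eq h
  rw [← natDegree_pow, hp]
  refine natDegree_eq_of_le_of_coeff_ne_zero ?_ ?_
  · rw [natDegree_le_iff_coeff_eq_zero]
    intro N hN
    rw [coeff_sub, coeff_add, coeff_X_pow, coeff_X, if_neg (by omega : ¬ 1 = N),
      coeff_X_sub_C_pow]
    rcases (by omega : N = d ∨ d < N) with rfl | hlt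
    · simp
    · rw [if_neg (by omega), Nat.choose_eq_zero_of_lt hlt]
      simp
  · rw [coeff_sub, coeff_add, coeff_X_pow, coeff_X, if_neg (by omega : ¬ 1 = d - 1),
      if_neg (by omega : ¬ d - 1 = d), coeff_X_sub_C_pow, (by omega : d - (d - 1) = 1),
      Nat.choose_symm_of_eq_add (by omega : d = d - 1 + 1), Nat.choose_one_right]
    have : (d : ℂ) ≠ 0 := by exact_mod_cast (by omega : d ≠ 0)
    simp [ha, this]

/-- With `q = p(a - X)`, the odd parity of `d` gives `(p - q) (p + q) = 2 X - a`; since `p - q` is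
antisymmetric under `X ↦ a - X` it is not constant, so `p + q` is, and `p` is linear. -/
lemma eq_three_of_sq_add_eq {d : ℕ} (hd : 3 ≤ d) {p : ℂ[X]} {a : ℂ}
    (h : p ^ 2 + (X - C a) ^ d = X ^ d + X) : d = 3 := by
  obtain ⟨-, hk⟩ := natDegree_of_pow_add_eq le_rfl hd h
  have hodd : Odd d := ⟨p.natDegree, by omega⟩
  set q := p.comp (C a - X) with hq
  have hqp : q.comp (C a - X) = p := by simp [hq, comp_assoc]
  have h' : q ^ 2 + (-X) ^ d = (-(X - C a)) ^ d + (C a - X) := by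
    have := congrArg (fun r : ℂ[X] => r.comp (C a - X)) h
    simpa [hq] using this
  rw [hodd.neg_pow, hodd.neg_pow] at h'
  have hprod : (p - q) * (p + q) = C 2 * X - C a := by
    rw [C_ofNat]
    linear_combination h - h'
  have hdeg : (C 2 * X - C a : ℂ[X]).natDegree = 1 := by
    rw [natDegree_sub_C, natDegree_C_mul_X _ two_ne_zero]
  have hne : (C 2 * X - C a : ℂ[X]) ≠ 0 := by
    intro h0
    rw [h0, natDegree_zero] at hdeg
    omega
  have ht0 : p - q ≠ 0 := fun h0 => hne (by rw [← hprod, h0, zero_mul])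
  have hs0 : p + q ≠ 0 := fun h0 => hne (by rw [← hprod, h0, mul_zero])
  have hsum := natDegree_mul ht0 hs0
  rw [hprod, hdeg] at hsum
  have ht : (p - q).natDegree ≠ 0 := by
    intro h0
    obtain ⟨c, hc⟩ := natDegree_eq_zero.1 h0
    have hanti : (p - q).comp (C a - X) = -(p - q) := by
      rw [sub_comp, hqp, ← hq, neg_sub]
    rw [← hc, C_comp] at hanti
    exact ht0 (by rw [← hc]; exact self_eq_neg.1 hanti)
  have hp : (C 2 * p).natDegree ≤ 1 := by
    have : C 2 * p = (p - q) + (p + q) := by rw [C_ofNat]; ring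
    rw [this]
    exact (natDegree_add_le _ _).trans (max_le (by omega) (by omega))
  rw [natDegree_C_mul two_ne_zero] at hp
  omega

/-- If `p ^ n = g` with `g = X ^ d + X - (X - a) ^ d` and `3 ≤ n`, then `p ^ 2` divides
`(X - a) g' - d g`, which is a trinomial; combining it with its derivative, `p` divides
`(d - 2) X + a`. So `p` is a multiple of `X + a / (d - 2)`, whereas the two leading coefficients
of `p ^ n` force its root to be `a / 2`. -/
lemma pow_add_ne {n d : ℕ} (hn : 3 ≤ n) (hd : 3 ≤ d) {p : ℂ[X]} {a : ℂ} :
    p ^ n + (X - C a) ^ d ≠ X ^ d + X := by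
  intro h
  obtain ⟨ha, hk⟩ := natDegree_of_pow_add_eq (by omega) hd h
  obtain ⟨m, rfl⟩ : ∃ m, n = m + 3 := ⟨n - 3, by omega⟩
  obtain ⟨e, rfl⟩ : ∃ e, d = e + 2 := ⟨d - 2, by omega⟩
  have he : 1 ≤ e := by omega
  rw [(by omega : e + 2 - 1 = e + 1)] at hk
  have hdvd : p ∣ C (e : ℂ) * X + C a := by
    have hder := congrArg derivative h
    simp only [derivative_add, derivative_pow, derivative_sub, derivative_X, derivative_C,
      (by omega : m + 3 - 1 = m + 2), (by omega : e + 2 - 1 = e + 1)] at hder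
    set w : ℂ[X] := p ^ m * ((X - C a) * (C ((m : ℂ) + 3) * derivative p)
      - C ((e : ℂ) + 2) * p) with hw
    have hT : p ^ 2 * w = -(C a * C ((e : ℂ) + 2) * X ^ (e + 1)) - C ((e : ℂ) + 1) * X - C a := by
      rw [hw]
      simp only [Nat.cast_add, map_add, map_natCast, C_ofNat, C_1, Nat.cast_ofNat] at hder ⊢
      linear_combination (X - C a) * hder - ((e : ℂ[X]) + 2) * h
    have hT' := congrArg derivative hT
    simp only [derivative_mul, derivative_pow, derivative_sub, derivative_neg, derivative_X,
      derivative_C, Nat.add_sub_cancel, (by omega : 2 - 1 = 1)] at hT'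
    have key : p * (X * (2 * derivative p * w + p * derivative w) - C ((e : ℂ) + 1) * (p * w)) =
        C ((e : ℂ) + 1) * (C (e : ℂ) * X + C a) := by
      simp only [Nat.cast_add, map_add, map_natCast, C_ofNat, C_1, Nat.cast_ofNat,
        Nat.cast_one] at hT hT' ⊢
      linear_combination X * hT' - ((e : ℂ[X]) + 1) * hT
    have hu : IsUnit (C ((e : ℂ) + 1)) := by
      rw [isUnit_C, isUnit_iff_ne_zero]
      exact Nat.cast_add_one_ne_zero e
    exact hu.dvd_mul_left.1 ⟨_, key.symm⟩
  have he0 : (e : ℂ) ≠ 0 := by exact_mod_cast (by omega : e ≠ 0)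
  have hlin : (C (e : ℂ) * X + C a).natDegree = 1 := natDegree_linear he0
  have hp1 : p.natDegree ≤ 1 := by
    rw [← hlin]
    refine natDegree_le_of_dvd hdvd fun h0 => ?_
    rw [h0, natDegree_zero] at hlin
    omega
  have hp1' : p.natDegree = 1 := by
    rcases Nat.eq_zero_or_pos p.natDegree with h0 | h0
    · rw [h0] at hk; omega
    · omega
  obtain ⟨u, hu, v, rfl⟩ := natDegree_eq_one.1 hp1'
  rw [hp1', mul_one] at hk
  set r := -v / u with hr
  have hv : v = -(u * r) := by rw [hr]; field_simp
  have hroot : (e : ℂ) * r + a = 0 := by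
    obtain ⟨s, hs⟩ := hdvd
    have := congrArg (eval r) hs
    simpa [hv] using this
  have hfac : C u * X + C v = C u * (X - C r) := by rw [hv]; simp; ring
  rw [hfac, hk, mul_pow, ← C_pow] at h
  have hc1 := congrArg (fun q : ℂ[X] => q.coeff (e + 1)) h
  have hc2 := congrArg (fun q : ℂ[X] => q.coeff e) h
  have hch : (((e + 2).choose e : ℕ) : ℂ) = (e + 2) * (e + 1) / 2 := by
    rw [Nat.choose_symm_add, Nat.cast_choose_two]
    push_cast
    ring
  have hch1 : (e + 2).choose (e + 1) = e + 2 := by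
    exact Nat.choose_succ_self_right (e + 1)
  have hch2 : (e + 1).choose e = e + 1 := Nat.choose_succ_self_right e
  simp only [coeff_add, coeff_C_mul, coeff_X_sub_C_pow, coeff_X_pow, coeff_X, hch, hch1, hch2,
    Nat.choose_self, Nat.sub_self, (by omega : e + 2 - (e + 1) = 1),
    (by omega : e + 1 - e = 1), (by omega : e + 2 - e = 2), if_neg (by omega : ¬ e + 1 = e + 2),
    if_neg (by omega : ¬ e = e + 2), if_neg (by omega : ¬ 1 = e + 1),
    if_neg (by omega : ¬ 1 = e)] at hc1 hc2
  push_cast at hc1 hc2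
  have h1 : (e : ℂ) + 1 ≠ 0 := Nat.cast_add_one_ne_zero e
  have h2 : (e : ℂ) + 2 ≠ 0 := by exact_mod_cast (by omega : e + 2 ≠ 0)
  have h3 : a * (((e : ℂ) + 1) * ((e + 2) * (e + 2))) * a = 0 := by
    linear_combination (2 * r * (e : ℂ) * (e + 1)) * hc1 + 2 * e * hc2
      + 2 * (e + 1) * (e + 2) * a * hroot
  exact mul_ne_zero (mul_ne_zero ha (mul_ne_zero h1 (mul_ne_zero h2 h2))) ha h3

lemma eq_two_or_of_pow_add_eq {n d : ℕ} (hn : 2 ≤ n) (hd : 2 ≤ d) {p : ℂ[X]} {a : ℂ}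
    (h : p ^ n + (X - C a) ^ d = X ^ d + X) : d = 2 ∨ (n = 2 ∧ d = 3) := by
  rcases hd.eq_or_lt with rfl | hd
  · exact .inl rfl
  rcases hn.eq_or_lt with rfl | hn
  · exact .inr ⟨rfl, eq_three_of_sq_add_eq hd h⟩
  · exact absurd h (pow_add_ne hn hd)

end CurveXdX

/-! ### The coordinate ring is integrally closed -/

namespace CurveXdX
open Polynomial

variable (n d : ℕ)

lemma aeval_y_equation : aeval (y n d) (equation n d) = 0 := by
  rw [y, aeval_algebraMap_apply, aeval_def]
  change algebraMap _ _ (eval₂ (AdjoinRoot.of _) _ _) = _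
  rw [AdjoinRoot.eval₂_root, map_zero]

variable [n.AtLeastTwo]

lemma isIntegral_y : IsIntegral ℂ[X] (y n d) :=
  ⟨equation n d, equation_monic n d, aeval_y_equation n d⟩

variable [d.AtLeastTwo]

lemma squarefree_X_pow_add_X : Squarefree (X ^ d + X : ℂ[X]) := by
  have hd := Nat.AtLeastTwo.prop (n := d)
  obtain ⟨e, rfl⟩ : ∃ e, d = e + 2 := ⟨d - 2, by omega⟩
  -- With `g = X ^ d + X`: `(d - 1) X = d g - X g'` and `1 = g' - d X ^ (d - 1)`.
  refine Separable.squarefree ⟨-C (((e : ℂ) + 2) ^ 2 / (e + 1)) * X ^ e,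
    1 + C (((e : ℂ) + 2) / (e + 1)) * X ^ (e + 1), ?_⟩
  have h1 : (e : ℂ) + 1 ≠ 0 := Nat.cast_add_one_ne_zero e
  have h2 : (C (((e : ℂ) + 2) ^ 2 / (e + 1)) : ℂ[X]) =
      C (((e : ℂ) + 2) / (e + 1)) * C ((e : ℂ) + 2) := by
    rw [← C_mul]; congr 1; ring
  have h3 : (C ((e : ℂ) + 2) : ℂ[X]) =
      C (((e : ℂ) + 2) / (e + 1)) * (C ((e : ℂ) + 2) - 1) := by
    rw [← C_1, ← C_sub, ← C_mul]; congr 1; field_simp; ring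
  simp only [derivative_add, derivative_X_pow, derivative_X, (by omega : e + 2 - 1 = e + 1)]
  rw [h2]
  push_cast
  linear_combination X ^ (e + 1) * h3

instance : FaithfulSMul ℂ[X] (CoordinateRing n d) := by
  rw [faithfulSMul_iff_algebraMap_injective]
  refine AdjoinRoot.of.injective_of_degree_ne_zero ?_
  have hn := Nat.AtLeastTwo.prop (n := n)
  rw [degree_eq_natDegree (equation_monic n d).ne_zero, equation_natDegree]
  exact_mod_cast (by omega : n ≠ 0)

instance : Module.Finite ℂ[X] (CoordinateRing n d) := (equation_monic n d).finite_adjoinRoot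

lemma minpoly_y : minpoly ℂ[X] (y n d) = equation n d := by
  have hint := isIntegral_y n d
  have hdvd := minpoly.isIntegrallyClosed_dvd hint (aeval_y_equation n d)
  refine eq_of_monic_of_associated (minpoly.monic hint) (equation_monic n d) ?_
  exact (minpoly.prime_of_isIntegrallyClosed hint).irreducible.associated_of_dvd
    (equation_irreducible n d) hdvd

lemma isEisensteinAt_equation {p : ℂ[X]} (hp : Prime p) (hpd : p ∣ X ^ d + X) :
    (equation n d).IsEisensteinAt (Ideal.span {p}) where
  leading := by
    rw [(equation_monic n d).leadingCoeff, Ideal.mem_span_singleton]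
    exact hp.not_dvd_one
  mem := by
    intro k hk
    rw [equation_natDegree] at hk
    rw [Ideal.mem_span_singleton, equation, coeff_sub, coeff_X_pow, if_neg (by omega), coeff_C]
    split_ifs
    · rwa [zero_sub, dvd_neg]
    · simp
  notMem := by
    have hn := Nat.AtLeastTwo.prop (n := n)
    rw [Ideal.span_singleton_pow, Ideal.mem_span_singleton, equation, coeff_sub, coeff_X_pow,
      if_neg (by omega), coeff_C_zero, zero_sub, dvd_neg, sq]
    exact fun h => hp.not_isUnit (squarefree_X_pow_add_X d p h)

local instance : Algebra (FractionRing ℂ[X]) (FunctionField n d) :=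
  FractionRing.liftAlgebra ℂ[X] (FunctionField n d)

lemma algebra_adjoin_y : Algebra.adjoin (FractionRing ℂ[X]) {y n d} = ⊤ := by
  have hint : IsIntegral (FractionRing ℂ[X]) (y n d) := (isIntegral_y n d).tower_top
  rw [← IntermediateField.adjoin_simple_toSubalgebra_of_isAlgebraic hint.isAlgebraic,
    ← IntermediateField.top_toSubalgebra, IntermediateField.toSubalgebra_inj, eq_top_iff]
  intro f _
  set E := IntermediateField.adjoin (FractionRing ℂ[X]) {y n d}
  have hR : ∀ a : CoordinateRing n d, algebraMap _ (FunctionField n d) a ∈ E := by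
    intro a
    induction a using AdjoinRoot.induction_on with
    | ih q =>
      induction q using Polynomial.induction_on' with
      | add p q hp hq => rw [map_add, map_add]; exact add_mem hp hq
      | monomial k c =>
        rw [← C_mul_X_pow_eq_monomial, map_mul, map_pow, map_mul, map_pow, AdjoinRoot.mk_X,
          AdjoinRoot.mk_C]
        refine mul_mem ?_ (pow_mem (IntermediateField.mem_adjoin_simple_self _ _) k)
        have : algebraMap (CoordinateRing n d) (FunctionField n d) (AdjoinRoot.of _ c) =
            algebraMap (FractionRing ℂ[X]) _ (algebraMap ℂ[X] _ c) := by
          rw [← IsScalarTower.algebraMap_apply]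
          rfl
        rw [this]
        exact E.algebraMap_mem _
  obtain ⟨a, b, hb, rfl⟩ := IsFractionRing.div_surjective (A := CoordinateRing n d) f
  exact div_mem (hR a) (hR b)

/-- The powers of `y` as a basis of the function field over `ℂ(x)`. -/
def powerBasisY : PowerBasis (FractionRing ℂ[X]) (FunctionField n d) :=
  PowerBasis.ofAdjoinEqTop (isIntegral_y n d).tower_top (algebra_adjoin_y n d)

lemma powerBasisY_gen : (powerBasisY n d).gen = y n d := PowerBasis.ofAdjoinEqTop_gen _ _

lemma minpoly_fractionRing_y : minpoly (FractionRing ℂ[X]) (y n d) =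
    (equation n d).map (algebraMap ℂ[X] (FractionRing ℂ[X])) := by
  rw [minpoly.isIntegrallyClosed_eq_field_fractions' _ (isIntegral_y n d), minpoly_y]

instance : FiniteDimensional (FractionRing ℂ[X]) (FunctionField n d) := (powerBasisY n d).finite

/-- Up to a nonzero constant, the discriminant of `1, y, …, y ^ (n - 1)` is the norm of
`n * y ^ (n - 1)`, that is, `(X ^ d + X) ^ (n - 1)`. -/
lemma exists_discr_eq : ∃ u : ℂ[X], IsUnit u ∧
    Algebra.discr (FractionRing ℂ[X]) (powerBasisY n d).basis =
      algebraMap ℂ[X] _ (u * (X ^ d + X) ^ (n - 1)) := by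
  have hn := Nat.AtLeastTwo.prop (n := n)
  have hcoeff : (equation n d).coeff 0 = -(X ^ d + X) := by
    rw [equation, coeff_sub, coeff_X_pow, if_neg (by omega), coeff_C_zero, zero_sub]
  have hderiv : derivative (equation n d) = C (n : ℂ[X]) * X ^ (n - 1) := by
    rw [equation, derivative_sub, derivative_C, sub_zero, derivative_X_pow]
  have hnorm : Algebra.norm (FractionRing ℂ[X]) (y n d) =
      algebraMap ℂ[X] _ ((-1) ^ (powerBasisY n d).dim * -(X ^ d + X)) := by
    have := Algebra.PowerBasis.norm_gen_eq_coeff_zero_minpoly (powerBasisY n d)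
    rw [powerBasisY_gen, minpoly_fractionRing_y, coeff_map] at this
    rw [this, hcoeff]
    simp only [map_mul, map_pow, map_neg, map_one]
  have hder : aeval (powerBasisY n d).gen
      (derivative (minpoly (FractionRing ℂ[X]) (powerBasisY n d).gen)) =
      algebraMap (FractionRing ℂ[X]) (FunctionField n d) n * y n d ^ (n - 1) := by
    rw [powerBasisY_gen, minpoly_fractionRing_y, derivative_map, aeval_map_algebraMap, hderiv]
    simp
  refine ⟨(-1) ^ (Module.finrank (FractionRing ℂ[X]) (FunctionField n d) *
      (Module.finrank (FractionRing ℂ[X]) (FunctionField n d) - 1) / 2) *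
      ((n : ℂ[X]) ^ (Module.finrank (FractionRing ℂ[X]) (FunctionField n d)) *
        (((-1) ^ (powerBasisY n d).dim * -1) ^ (n - 1))), ?_, ?_⟩
  · have h1 : IsUnit (-1 : ℂ[X]) := isUnit_one.neg
    have h2 : IsUnit (n : ℂ[X]) := by
      rw [← map_natCast C, isUnit_C, isUnit_iff_ne_zero]
      exact_mod_cast (by omega : n ≠ 0)
    exact (h1.pow _).mul ((h2.pow _).mul (((h1.pow _).mul h1).pow _))
  · rw [Algebra.discr_powerBasis_eq_norm, hder, map_mul, map_pow, hnorm, Algebra.norm_algebraMap]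
    simp only [map_mul, map_pow, map_neg, map_one, map_natCast]
    ring

/-- The primes dividing `q` are cancelled one at a time, the equation being Eisenstein at each. -/
lemma mem_adjoin_y_of_smul_mem {z : FunctionField n d} (hz : IsIntegral ℂ[X] z) {q : ℂ[X]}
    (hq : q ≠ 0) (hqd : ∀ p, Prime p → p ∣ q → p ∣ X ^ d + X)
    (h : q • z ∈ Algebra.adjoin ℂ[X] {y n d}) : z ∈ Algebra.adjoin ℂ[X] {y n d} := by
  induction q using UniqueFactorizationMonoid.induction_on_prime generalizing z with
  | h₁ => exact absurd rfl hq
  | h₂ u hu =>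
    obtain ⟨u, rfl⟩ := hu
    have := Subalgebra.smul_mem _ h ((u⁻¹ : ℂ[X]ˣ) : ℂ[X])
    rwa [smul_smul, Units.inv_mul, one_smul] at this
  | h₃ a p ha hp ih =>
    refine ih hz ha (fun p' hp' h' => hqd p' hp' (h'.mul_left _)) ?_
    have hei := isEisensteinAt_equation n d hp (hqd p hp (dvd_mul_right _ _))
    rw [← minpoly_y, ← powerBasisY_gen] at hei
    rw [mul_smul] at h
    have := mem_adjoin_of_smul_prime_smul_of_minpoly_isEisensteinAt (B := powerBasisY n d) hp
      (by rw [powerBasisY_gen]; exact isIntegral_y n d) (hz.smul a)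
      (by rwa [powerBasisY_gen]) hei
    rwa [powerBasisY_gen] at this

lemma mem_adjoin_y_of_isIntegral {z : FunctionField n d} (hz : IsIntegral ℂ[X] z) :
    z ∈ Algebra.adjoin ℂ[X] {y n d} := by
  obtain ⟨u, hu, hdisc⟩ := exists_discr_eq n d
  have := Algebra.discr_mul_isIntegral_mem_adjoin (FractionRing ℂ[X]) (R := ℂ[X])
    (B := powerBasisY n d) (by rw [powerBasisY_gen]; exact isIntegral_y n d) hz
  rw [hdisc, powerBasisY_gen, algebraMap_smul] at this
  refine mem_adjoin_y_of_smul_mem n d hz ?_ (fun p hp hpq => ?_) this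
  · exact mul_ne_zero hu.ne_zero (pow_ne_zero _ (squarefree_X_pow_add_X d).ne_zero)
  · rcases hp.dvd_or_dvd hpq with h | h
    · exact absurd (isUnit_of_dvd_unit h hu) hp.not_isUnit
    · exact hp.dvd_of_dvd_pow h

instance : IsIntegralClosure (CoordinateRing n d) ℂ[X] (FunctionField n d) where
  algebraMap_injective := IsFractionRing.injective _ _
  isIntegral_iff {z} := by
    constructor
    · intro hz
      have hle : Algebra.adjoin ℂ[X] {y n d} ≤
          (IsScalarTower.toAlgHom ℂ[X] (CoordinateRing n d) (FunctionField n d)).range :=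
        Algebra.adjoin_le (Set.singleton_subset_iff.2 ⟨AdjoinRoot.root _, rfl⟩)
      exact hle (mem_adjoin_y_of_isIntegral n d hz)
    · rintro ⟨a, rfl⟩
      exact (Algebra.IsIntegral.isIntegral a).algebraMap

/-- The affine curve is smooth. -/
instance : IsDedekindDomain (CoordinateRing n d) :=
  IsIntegralClosure.isDedekindDomain ℂ[X] (FractionRing ℂ[X]) (FunctionField n d) _

end CurveXdX

/-! ### Points of curves and torsion in the Jacobian -/

namespace CurvePoint

variable {F : Type*} [Field F] [Algebra ℂ F] (P : CurvePoint F)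

lemma ord_nonneg_iff {f : F} (hf : f ≠ 0) : 0 ≤ P.ord f ↔ P.val f ≤ 1 := by
  rw [ord, neg_nonneg, WithZero.log_le_iff_le_exp (by simpa using hf), WithZero.exp_zero]

lemma ord_pos_iff {f : F} (hf : f ≠ 0) : 0 < P.ord f ↔ P.val f < 1 := by
  rw [ord, neg_pos, WithZero.log_lt_iff_lt_exp (by simpa using hf), WithZero.exp_zero]

/-- The point of the curve given by a nonzero prime ideal of a Dedekind domain with fraction
field `F`. -/
def ofPrime {R : Type*} [CommRing R] [IsDedekindDomain R] [Algebra ℂ R] [Algebra R F]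
    [IsFractionRing R F] [IsScalarTower ℂ R F] (v : IsDedekindDomain.HeightOneSpectrum R) :
    CurvePoint F where
  val := v.valuation F
  surjective := v.valuation_surjective F
  trivialOn := Valuation.IsTrivialOn.of_le_one _ fun c => by
    rw [IsScalarTower.algebraMap_apply ℂ R F]
    exact v.valuation_le_one _

end CurvePoint

lemma exists_divisor_of_nsmul_abelJacobi_eq_zero {F : Type*} [Field F] [Algebra ℂ F]
    {B P : CurvePoint F} {k : ℕ} (h : k • abelJacobi B P = 0) :
    ∃ f : F, f ≠ 0 ∧ ∀ Q : CurvePoint F,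
      (Finsupp.single P (k : ℤ) - Finsupp.single B (k : ℤ)) Q = Q.ord f := by
  classical
  rw [abelJacobi, ← QuotientAddGroup.mk_nsmul, QuotientAddGroup.eq_zero_iff,
    AddSubgroup.mem_addSubgroupOf] at h
  obtain ⟨f, hf, hD⟩ := h
  refine ⟨f, hf, fun Q => ?_⟩
  rw [← hD]
  simp [Finsupp.single_apply, mul_sub]

namespace CurveXdX
open Polynomial

/-! ### Evaluation of regular functions -/

/-- Evaluation of regular functions at the point `(r, s)` of the affine curve. -/
def evalAt (n d : ℕ) {r s : ℂ} (h : s ^ n = r ^ d + r) : CoordinateRing n d →+* ℂ :=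
  AdjoinRoot.lift (evalRingHom r) s (by
    rw [equation, eval₂_sub, eval₂_X_pow, eval₂_C]
    simp [h])

lemma evalAt_mk {n d : ℕ} {r s : ℂ} (h : s ^ n = r ^ d + r) (q : ℂ[X][X]) :
    evalAt n d h (AdjoinRoot.mk _ q) = q.eval₂ (evalRingHom r) s :=
  AdjoinRoot.lift_mk _ _

variable (n d : ℕ) [n.AtLeastTwo] [d.AtLeastTwo]

/-! ### Functions with poles only at infinity -/

/-- A function without poles outside infinity lies in the coordinate ring. -/
lemma exists_algebraMap_eq (hnd : n.Coprime d) {f : FunctionField n d} (hf : f ≠ 0)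
    (h : ∀ Q : CurvePoint (FunctionField n d), Q ≠ infinity n d hnd → 0 ≤ Q.ord f) :
    ∃ a : CoordinateRing n d, algebraMap _ _ a = f := by
  refine IsDedekindDomain.HeightOneSpectrum.mem_integers_of_valuation_le_one
    (FunctionField n d) f fun v => ?_
  refine ((CurvePoint.ofPrime v).ord_nonneg_iff hf).1 (h _ fun heq => ?_)
  have hpole := (existsUnique_pole_x n d hnd).choose_spec.1
  change (infinity n d hnd).ord (x n d) < 0 at hpole
  rw [← heq] at hpole
  refine hpole.not_ge ((CurvePoint.ord_nonneg_iff _ ?_).2 (v.valuation_le_one _))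
  intro h0
  rw [h0] at hpole
  simp [CurvePoint.ord] at hpole

/-- In `∑ c_j(x) y ^ j` with `j < n` the terms have distinct pole orders at infinity, so that the
pole order of the sum is the largest of them. -/
lemma exists_val_sum_eq (hnd : n.Coprime d) {q : ℂ[X][X]} (hq : q ≠ 0) (hqn : q.natDegree < n)
    (P : CurvePoint (FunctionField n d)) {m : ℤ} (hm : 0 < m)
    (hx : P.val (x n d) = WithZero.exp (n * m)) (hy : P.val (y n d) = WithZero.exp (d * m)) :
    ∃ j ∈ q.support, (∀ i ∈ q.support,
        n * (q.coeff i).natDegree + d * i ≤ n * (q.coeff j).natDegree + d * j) ∧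
      P.val (q.sum fun j c => aeval (x n d) c * y n d ^ j) =
        WithZero.exp ((n * (q.coeff j).natDegree + d * j : ℕ) * m) := by
  classical
  have hn := Nat.AtLeastTwo.prop (n := n)
  obtain ⟨j, hj, hmax⟩ := Finset.exists_max_image q.support
    (fun i => n * (q.coeff i).natDegree + d * i) (nonempty_support_iff.2 hq)
  refine ⟨j, hj, hmax, ?_⟩
  have htriv := P.trivialOn
  have hx1 : 1 < P.val (x n d) := by
    rw [hx, ← WithZero.exp_zero, WithZero.exp_lt_exp]
    have : (0 : ℤ) < n := by omega
    positivity
  have hterm : ∀ i ∈ q.support, P.val (aeval (x n d) (q.coeff i) * y n d ^ i) =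
      WithZero.exp ((n * (q.coeff i).natDegree + d * i : ℕ) * m) := by
    intro i hi
    rw [map_mul, map_pow, valuation_aeval_eq_valuation_X_pow_natDegree_of_one_lt_valuation_X
      (x n d) hx1 (mem_support_iff.1 hi), hx, hy, ← WithZero.exp_nsmul, ← WithZero.exp_nsmul,
      ← WithZero.exp_add]
    congr 1
    simp only [nsmul_eq_mul]
    push_cast
    ring
  rw [Polynomial.sum, Valuation.map_sum_eq_of_lt _ hj, hterm j hj]
  intro i hi
  rw [Finset.mem_sdiff, Finset.mem_singleton] at hi
  rw [hterm i hi.1, hterm j hj, WithZero.exp_lt_exp]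
  refine mul_lt_mul_of_pos_right ?_ hm
  refine Int.ofNat_lt.2 (lt_of_le_of_ne (hmax i hi.1) fun heq => hi.2 ?_)
  have hi' : i < n := lt_of_le_of_lt (le_natDegree_of_mem_supp _ hi.1) hqn
  have hj' : j < n := lt_of_le_of_lt (le_natDegree_of_mem_supp _ hj) hqn
  have hmod : d * i ≡ d * j [MOD n] := by
    have : n * (q.coeff i).natDegree + d * i ≡ n * (q.coeff j).natDegree + d * j [MOD n] := by
      rw [heq]
    simpa [Nat.ModEq, Nat.mul_add_mod] using this
  exact (Nat.ModEq.cancel_left_of_coprime hnd hmod).eq_of_lt_of_lt hi' hj'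

/-- In fact `m = 1`, but `0 < m` is all that is needed. -/
lemma exists_pole_orders (hnd : n.Coprime d) : ∃ m : ℤ, 0 < m ∧
    (infinity n d hnd).val (x n d) = WithZero.exp (n * m) ∧
      (infinity n d hnd).val (y n d) = WithZero.exp (d * m) :=
  exists_val_eq n d hnd _ (existsUnique_pole_x n d hnd).choose_spec.1

/-- The pole orders of `x` and `y` at infinity being `n` and `d`, a function with a pole of
order exactly `d` at infinity and no other pole is `u y + c(x)` with `u ≠ 0` and
`n * deg c < d`. -/
lemma exists_eq_add_of_ord_infinity (hnd : n.Coprime d) (a : CoordinateRing n d)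
    (h : (infinity n d hnd).ord (algebraMap _ (FunctionField n d) a) = -d) :
    ∃ (u : ℂ) (c : ℂ[X]), u ≠ 0 ∧ n * c.natDegree < d ∧
      a = AdjoinRoot.mk (equation n d) (C (C u) * X + C c) := by
  have hn := Nat.AtLeastTwo.prop (n := n)
  have hd := Nat.AtLeastTwo.prop (n := d)
  obtain ⟨q₀, rfl⟩ := AdjoinRoot.mk_surjective a
  have hmon := equation_monic n d
  obtain ⟨q, hqn, hmk⟩ : ∃ q : ℂ[X][X], q.natDegree < n ∧
      AdjoinRoot.mk (equation n d) q = AdjoinRoot.mk (equation n d) q₀ := by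
    refine ⟨q₀ %ₘ equation n d, ?_, ?_⟩
    · have := natDegree_modByMonic_lt q₀ hmon (fun h1 => by
        have := equation_natDegree n d
        rw [h1, natDegree_one] at this
        omega)
      rwa [equation_natDegree] at this
    · rw [AdjoinRoot.mk_eq_mk, modByMonic_eq_sub_mul_div]
      exact ⟨-(q₀ /ₘ equation n d), by ring⟩
  rw [← hmk] at h ⊢
  have hq : q ≠ 0 := by
    rintro rfl
    simp [CurvePoint.ord] at h
    omega
  obtain ⟨m, hm, hx, hy⟩ := exists_pole_orders n d hnd
  obtain ⟨j, hj, hmax, hval⟩ := exists_val_sum_eq n d hnd hq hqn _ hm hx hy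
  rw [CurvePoint.ord, algebraMap_mk, hval, WithZero.log_exp, neg_inj] at h
  -- `h` says that the largest weight times `m` is `d`.
  have hle : n * (q.coeff j).natDegree + d * j ≤ d := by
    have h0 : (0 : ℤ) ≤ (n * (q.coeff j).natDegree + d * j : ℕ) := Int.natCast_nonneg _
    have : ((n * (q.coeff j).natDegree + d * j : ℕ) : ℤ) ≤ d := by nlinarith
    exact_mod_cast this
  have hndvd : ¬ n ∣ d := fun hdvd => by
    have := Nat.eq_one_of_dvd_coprimes hnd dvd_rfl hdvd
    omega
  have hdeg : ∀ i, i ∈ q.support → i ≤ 1 ∧ (i = 1 → (q.coeff i).natDegree = 0) := by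
    intro i hi
    have h1 := (hmax i hi).trans hle
    have h2 : i ≤ 1 := by
      by_contra hlt
      have : d * 2 ≤ d * i := Nat.mul_le_mul_left d (by omega)
      omega
    refine ⟨h2, ?_⟩
    rintro rfl
    have : n * (q.coeff 1).natDegree = 0 := by omega
    rcases Nat.mul_eq_zero.1 this with h0 | h0
    · omega
    · exact h0
  -- Otherwise `f` is a polynomial in `x`, whose pole order is divisible by `n`.
  have hj1 : j = 1 := by
    by_contra hne
    have hj0 : j = 0 := by have := (hdeg j hj).1; omega
    subst hj0
    apply hndvd
    have : (n : ℤ) ∣ d := ⟨(q.coeff 0).natDegree * m, by rw [← h]; push_cast; ring⟩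
    exact_mod_cast this
  subst hj1
  obtain ⟨u, hu⟩ := natDegree_eq_zero.1 ((hdeg 1 hj).2 rfl)
  refine ⟨u, q.coeff 0, ?_, ?_, ?_⟩
  · rintro rfl
    rw [C_0] at hu
    exact mem_support_iff.1 hj hu.symm
  · by_cases h0 : 0 ∈ q.support
    · refine lt_of_le_of_ne ?_ fun heq => hndvd ⟨_, heq.symm⟩
      have := (hmax 0 h0).trans hle
      omega
    · rw [notMem_support_iff.1 h0, natDegree_zero]
      omega
  · rw [hu]
    congr 1
    refine eq_X_add_C_of_natDegree_le_one ?_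
    exact natDegree_le_iff_coeff_eq_zero.2 fun i hi => by
      by_contra hne
      have := (hdeg i (mem_support_iff.2 hne)).1
      omega

variable {n d}

/-! ### Points of the affine curve -/

/-- Every solution `(r, s)` of the equation is a point of the curve. -/
lemma exists_point {r s : ℂ} (h : s ^ n = r ^ d + r) :
    ∃ Q : CurvePoint (FunctionField n d), ∀ a : CoordinateRing n d, evalAt n d h a = 0 →
      Q.val (algebraMap _ _ a) < 1 := by
  have hne : RingHom.ker (evalAt n d h) ≠ ⊥ := by
    intro hbot
    have hmem : algebraMap ℂ[X] (CoordinateRing n d) (X - C r) ∈ RingHom.ker (evalAt n d h) := by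
      rw [RingHom.mem_ker]
      change evalAt n d h (AdjoinRoot.mk _ (C (X - C r))) = 0
      rw [evalAt_mk]
      simp
    rw [hbot, Ideal.mem_bot] at hmem
    exact X_sub_C_ne_zero r (FaithfulSMul.algebraMap_injective ℂ[X] (CoordinateRing n d)
      (by rw [hmem, map_zero]))
  let v : IsDedekindDomain.HeightOneSpectrum (CoordinateRing n d) :=
    ⟨RingHom.ker (evalAt n d h), RingHom.ker_isPrime _, hne⟩
  exact ⟨CurvePoint.ofPrime v, fun a ha => (v.valuation_lt_one_iff_mem a).2 ha⟩

/-- If `u y + c(x)` has no zero other than `P`, then `x ^ d + x - p ^ n` with `p = -c / u` has no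
two distinct roots, since each root `r` gives a zero `(r, p(r))` of `u y + c(x)`. -/
lemma roots_eq_of_forall_pos_ord {P : CurvePoint (FunctionField n d)} {u : ℂ} {c : ℂ[X]}
    (hu : u ≠ 0) (hf : algebraMap _ (FunctionField n d)
      (AdjoinRoot.mk (equation n d) (C (C u) * X + C c)) ≠ 0)
    (hP : ∀ Q : CurvePoint (FunctionField n d), 0 < Q.ord (algebraMap _ (FunctionField n d)
      (AdjoinRoot.mk (equation n d) (C (C u) * X + C c))) → Q = P) {r r' : ℂ}
    (hr : (-u⁻¹ * c.eval r) ^ n = r ^ d + r) (hr' : (-u⁻¹ * c.eval r') ^ n = r' ^ d + r') :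
    r = r' := by
  have key : ∀ r : ℂ, (-u⁻¹ * c.eval r) ^ n = r ^ d + r →
      P.val (x n d - algebraMap ℂ _ r) < 1 := by
    intro r hr
    obtain ⟨Q, hQ⟩ := exists_point hr
    have hQP : Q = P := hP Q ((Q.ord_pos_iff hf).2 (hQ _ (by
      rw [evalAt_mk]
      simp only [eval₂_add, eval₂_mul, eval₂_C, eval₂_X, coe_evalRingHom, eval_C]
      field_simp
      ring)))
    have := hQ (AdjoinRoot.mk _ (C (X - C r))) (by rw [evalAt_mk]; simp)
    rw [hQP, algebraMap_mk, sum_C_index (by simp)] at this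
    simpa using this
  by_contra hne
  have hlt := P.val.map_sub_lt (key r' hr') (key r hr)
  have htriv := P.trivialOn
  have h1 : P.val (algebraMap ℂ (FunctionField n d) (r - r')) = 1 :=
    htriv.eq_one _ (sub_ne_zero.2 hne)
  rw [sub_sub_sub_cancel_left, ← map_sub, h1] at hlt
  exact hlt.false

end CurveXdX

/-! ### The torsion condition -/

open Polynomial in
/-- A monic complex polynomial of degree `d` without two distinct roots is `(X - a) ^ d`. -/
lemma exists_eq_X_sub_C_pow {g : ℂ[X]} (hg : g.Monic) (h0 : g.natDegree ≠ 0)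
    (h : ∀ r r', g.IsRoot r → g.IsRoot r' → r = r') : ∃ a, g = (X - C a) ^ g.natDegree := by
  obtain ⟨a, ha⟩ := IsAlgClosed.exists_root g (by
    rw [degree_eq_natDegree hg.ne_zero]; exact_mod_cast h0)
  refine ⟨a, ?_⟩
  have hs := IsAlgClosed.splits g
  have hroots : g.roots = Multiset.replicate g.natDegree a := by
    rw [Multiset.eq_replicate, hs.natDegree_eq_card_roots]
    exact ⟨rfl, fun b hb => h b a (isRoot_of_mem_roots hb) ha⟩
  conv_lhs => rw [hs.eq_prod_roots_of_monic hg, hroots]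
  simp

open Polynomial CurveXdX in
theorem proposition6p1 (n d : ℕ) [n.AtLeastTwo] [d.AtLeastTwo] (hnd : n.Coprime d)
    (P : CurvePoint (CurveXdX.FunctionField n d)) (hP : P ≠ CurveXdX.infinity n d hnd)
    (htors : d • abelJacobi (CurveXdX.infinity n d hnd) P = 0) :
    d = 2 ∨ (n = 2 ∧ d = 3) := by
  classical
  have hn := Nat.AtLeastTwo.prop (n := n)
  have hd := Nat.AtLeastTwo.prop (n := d)
  obtain ⟨f, hf, hD⟩ := exists_divisor_of_nsmul_abelJacobi_eq_zero htors
  simp only [Finsupp.coe_sub, Pi.sub_apply, Finsupp.single_apply] at hD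
  -- `div f = d P - d ∞`, so `f` is regular on the affine curve.
  obtain ⟨a, rfl⟩ := exists_algebraMap_eq n d hnd hf fun Q hQ => by
    rw [← hD, if_neg hQ.symm]
    split_ifs <;> omega
  obtain ⟨u, c, hu, hc, rfl⟩ := exists_eq_add_of_ord_infinity n d hnd a (by
    rw [← hD, if_neg hP, if_pos rfl, zero_sub])
  -- `f` vanishes exactly where `y = p(x)`.
  set p : ℂ[X] := C (-u⁻¹) * c with hp
  have hpn : (p ^ n).natDegree < d := by
    rw [natDegree_pow, hp, natDegree_C_mul (by simpa using hu)]
    exact hc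
  have hg : (X ^ d + (X - p ^ n)).natDegree = d ∧ (X ^ d + (X - p ^ n)).Monic := by
    have hlt : (X - p ^ n).degree < (d : WithBot ℕ) := by
      refine (degree_sub_le _ _).trans_lt (max_lt ?_ ?_)
      · rw [degree_X]
        exact_mod_cast hd
      · exact degree_le_natDegree.trans_lt (by exact_mod_cast hpn)
    exact ⟨by
      rw [natDegree_add_eq_left_of_degree_lt (by rwa [degree_X_pow]), natDegree_X_pow], monic_X_pow_add hlt⟩
  obtain ⟨b, hb⟩ := exists_eq_X_sub_C_pow hg.2 (by omega) (fun r r' hr hr' => by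
    refine roots_eq_of_forall_pos_ord (P := P) hu hf (fun Q hQ => ?_) ?_ ?_
    · by_contra hne
      rw [← hD, if_neg (Ne.symm hne)] at hQ
      split_ifs at hQ <;> omega
    · simp only [IsRoot, hp, eval_add, eval_sub, eval_pow, eval_X, eval_mul, eval_C] at hr
      linear_combination -hr
    · simp only [IsRoot, hp, eval_add, eval_sub, eval_pow, eval_X, eval_mul, eval_C] at hr'
      linear_combination -hr')
  rw [hg.1] at hb
  exact eq_two_or_of_pow_add_eq hn hd (p := p) (a := b) (by rw [← hb]; ring)

end
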